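/- Let $p$ be an odd prime. Write each $\alpha\in\mathbb{Q}_p$ uniquely as $\alpha=\sum_{n\ge -r}a_np^n$ with integers $a_n\in\{-\frac{p-1}{2},\dots,\frac{p-1}{2}\}$, and put $s(\alpha)=\sum_{n\le 0}a_np^n$ and $t(\alpha)=\sum_{n\le -1}a_np^n$. The Browkin II expansion $[b_0,b_1,b_2,\dots]$ of $\alpha_0\in\mathbb{Q}_p$ is computed, for $n\ge 0$, by $b_n=s(\alpha_n)$ if $n$ is even; $b_n=t(\alpha_n)$ if $n$ is odd and $v_p(\alpha_n-t(\alpha_n))=0$; $b_n=t(\alpha_n)-\operatorname{sign}(t(\alpha_n))$ if $n$ is odd and $v_p(\alpha_n-t(\alpha_n))\neq 0$; and $\alpha_{n+1}=1/(\alpha_n-b_n)$, stopping if $\alpha_n=b_n$. For an integer $t\ge 2$ put $D_t=\dfrac{1-p^t}{(1-p)^2}\,p^2$. **Theorem.** (1) For every integer $t\ge 2$, $D_t$ is a square in $\mathbb{Q}_p$. Let $\sqrt{D_t}$ be the square root of $D_t$ in $\mathbb{Q}_p$ with $\sqrt{D_t}\equiv p \pmod{p^2}$. Then $$\pm\sqrt{D_t}=\left[0,\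 \pm\frac1p,\ \overline{\mp1,\ \mp\frac{2(p^{t-1}-1)}{(p-1)p^{t-1}},\ \mp1,\ \pm\frac2p}\,\right],$$ where the signs correspond: the denominators of the convergents of each continued fraction on the right are all non-zero, and its convergents converge in $\mathbb{Q}_p$ to the number on the left. The least period length of each of these two sequences is exactly $4$. If moreover $p\ge 5$, then the sequence on the right is exactly the sequence of partial quotients of the Browkin II expansion of $\pm\sqrt{D_t}$ (which in particular does not terminate). (2) $D_t$ is an integer for infinitely many $t\ge2$. Consequently, if $p\ge 5$, there are infinitely many integers $D$, all of the form $D_t$ with $t\ge 2$, which are squares in $\mathbb{Q}_p$ and both of whose square roots in $\mathbb{Q}_p$ have an infinite periodic Browkin II expansion with least period length exactly $4$ (this answers a question left open by Browkin). -/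

import Mathlib

open Filter Topology

namespace BrowkinII

/-- `a` is the sequence of balanced `p`-adic digits of `α`: `α = ∑ₙ aₙ pⁿ` with integers
`aₙ ∈ {-(p-1)/2, …, (p-1)/2}`, where `aₙ = 0` for all sufficiently negative `n`. -/
structure IsBalancedExpansion (p : ℕ) [Fact p.Prime] (α : ℚ_[p]) (a : ℤ → ℤ) : Prop where
  digit_le : ∀ n, 2 * |a n| ≤ (p : ℤ) - 1
  eventually_zero : ∃ r : ℤ, ∀ n, n < -r → a n = 0
  hasSum : HasSum (fun n : ℤ => (a n : ℚ_[p]) * (p : ℚ_[p]) ^ n) α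

lemma exists_digit (p : ℕ) [Fact p.Prime] (hp : p ≠ 2) (x : ℤ_[p]) :
    ∃ (d : ℤ) (y : ℤ_[p]), 2 * |d| ≤ (p : ℤ) - 1 ∧ x = (d : ℤ_[p]) + (p : ℤ_[p]) * y := by
  have hodd : Odd p := (Fact.out : p.Prime).odd_of_ne_two hp
  refine ⟨(PadicInt.toZMod x).valMinAbs, ?_⟩
  have h0 : x - (((PadicInt.toZMod x).valMinAbs : ℤ) : ℤ_[p]) ∈
      RingHom.ker (PadicInt.toZMod (p := p)) := by
    rw [RingHom.mem_ker, map_sub, map_intCast, ZMod.coe_valMinAbs, sub_self]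
  rw [PadicInt.ker_toZMod, PadicInt.maximalIdeal_eq_span_p, Ideal.mem_span_singleton] at h0
  obtain ⟨y, hy⟩ := h0
  refine ⟨y, ?_, by rw [← hy]; ring⟩
  have h1 := (PadicInt.toZMod x).natAbs_valMinAbs_le
  rw [Int.abs_eq_natAbs]
  obtain ⟨k, hk⟩ := hodd
  omega

/-- Every `p`-adic number (`p` odd) has a balanced digit expansion. -/
theorem exists_isBalancedExpansion (p : ℕ) [Fact p.Prime] (hp : p ≠ 2) (α : ℚ_[p]) :
    ∃ a, IsBalancedExpansion p α a := by
  have hp0 : (p : ℚ_[p]) ≠ 0 := by exact_mod_cast (Fact.out : p.Prime).ne_zero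
  have hp1 : (1 : ℝ) < p := by exact_mod_cast (Fact.out : p.Prime).one_lt
  choose d y hd hy using exists_digit p hp
  obtain ⟨r, hr⟩ : ∃ r : ℕ, ‖(p : ℚ_[p]) ^ r * α‖ ≤ 1 := by
    obtain ⟨r, hr⟩ := pow_unbounded_of_one_lt ‖α‖ hp1
    refine ⟨r, ?_⟩
    rw [norm_mul, norm_pow, Padic.norm_p, inv_pow, inv_mul_le_iff₀ (by positivity), mul_one]
    exact hr.le
  let x : ℕ → ℤ_[p] := fun k => y^[k] ⟨(p : ℚ_[p]) ^ r * α, hr⟩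
  have hx : ∀ k, x k = (d (x k) : ℤ_[p]) + (p : ℤ_[p]) * x (k + 1) := by
    intro k
    have h := hy (x k)
    have h2 : x (k + 1) = y (x k) := Function.iterate_succ_apply' _ _ _
    rw [h2]; exact h
  have hxq : ∀ k, (x k : ℚ_[p]) = (d (x k) : ℚ_[p]) + (p : ℚ_[p]) * (x (k + 1) : ℚ_[p]) := by
    intro k
    have h := congrArg (fun z : ℤ_[p] => (z : ℚ_[p])) (hx k)
    simpa using h
  have hpart : ∀ n, (p : ℚ_[p]) ^ r * α =
      ∑ k ∈ Finset.range n, (d (x k) : ℚ_[p]) * (p : ℚ_[p]) ^ k + (p : ℚ_[p]) ^ n * x n := by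
    intro n
    induction n with
    | zero =>
      have : (x 0 : ℚ_[p]) = (p : ℚ_[p]) ^ r * α := rfl
      rw [this]; simp
    | succ n ih =>
      rw [ih, Finset.sum_range_succ, hxq n]; ring
  have hgeom : Summable fun k : ℕ => ((p : ℝ)⁻¹) ^ k :=
    summable_geometric_of_lt_one (by positivity) (inv_lt_one_of_one_lt₀ hp1)
  have hsum : HasSum (fun k : ℕ => (d (x k) : ℚ_[p]) * (p : ℚ_[p]) ^ k) ((p : ℚ_[p]) ^ r * α) := by
    have hs : Summable fun k : ℕ => ‖(d (x k) : ℚ_[p]) * (p : ℚ_[p]) ^ k‖ := by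
      refine Summable.of_nonneg_of_le (fun _ => norm_nonneg _) (fun k => ?_) hgeom
      rw [norm_mul, norm_pow, Padic.norm_p]
      exact mul_le_of_le_one_left (by positivity) (Padic.norm_int_le_one _)
    rw [hasSum_iff_tendsto_nat_of_summable_norm hs, tendsto_iff_norm_sub_tendsto_zero]
    refine squeeze_zero (fun _ => norm_nonneg _) (fun n => ?_) hgeom.tendsto_atTop_zero
    rw [hpart n, sub_add_cancel_left, norm_neg, norm_mul, norm_pow, Padic.norm_p]
    exact mul_le_of_le_one_right (by positivity) (x n).2
  refine ⟨fun n => if -(r : ℤ) ≤ n then d (x (n + r).toNat) else 0, ?_, ⟨r, ?_⟩, ?_⟩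
  · intro n
    split_ifs
    · exact hd _
    · have : (1 : ℤ) < p := by exact_mod_cast (Fact.out : p.Prime).one_lt
      simp; omega
  · intro n hn
    rw [if_neg (by omega)]
  · have hinj : Function.Injective fun k : ℕ => (k : ℤ) - r := fun a b h => by
      simp only at h; omega
    rw [← hinj.hasSum_iff]
    · have h := hsum.mul_left ((p : ℚ_[p]) ^ (-(r : ℤ)))
      have e : (p : ℚ_[p]) ^ (-(r : ℤ)) * ((p : ℚ_[p]) ^ r * α) = α := by
        rw [zpow_neg, zpow_natCast, inv_mul_cancel_left₀ (pow_ne_zero _ hp0)]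
      rw [e] at h
      convert! h using 1
      funext k
      have : (-(r : ℤ) ≤ (k : ℤ) - r) := by omega
      simp only [Function.comp, this, if_true, sub_add_cancel, Int.toNat_natCast]
      rw [sub_eq_neg_add, zpow_add₀ hp0, zpow_natCast]
      ring
    · intro n hn
      have : ¬ (-(r : ℤ) ≤ n) := fun h => hn ⟨(n + r).toNat, by simp; omega⟩
      simp [this]

/-- The balanced digit expansion of a `p`-adic number is unique. -/
theorem IsBalancedExpansion.unique {p : ℕ} [Fact p.Prime] {α : ℚ_[p]} {a b : ℤ → ℤ}
    (ha : IsBalancedExpansion p α a) (hb : IsBalancedExpansion p α b) : a = b := by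
  have hp0 : (p : ℚ_[p]) ≠ 0 := by exact_mod_cast (Fact.out : p.Prime).ne_zero
  have hp1 : (1 : ℝ) < p := by exact_mod_cast (Fact.out : p.Prime).one_lt
  obtain ⟨r, hr⟩ := ha.eventually_zero
  obtain ⟨r', hr'⟩ := hb.eventually_zero
  have key : ∀ k : ℕ, ∀ n : ℤ, n < -(max r r') + k → a n = b n := by
    intro k
    induction k with
    | zero =>
      intro n hn
      rw [hr n (by have := le_max_left r r'; omega), hr' n (by have := le_max_right r r'; omega)]
    | succ k ih =>
      intro n hn
      by_cases hlt : n < -(max r r') + k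
      · exact ih n hlt
      have hn' : ∀ m, m < n → a m = b m := fun m hm => ih m (by push_cast at hn; omega)
      have hs := ha.hasSum.sub hb.hasSum
      rw [sub_self] at hs
      have hpos : (0 : ℝ) < (p : ℝ) ^ (-(n + 1)) := by positivity
      have hterm : ∀ m, m ≠ n →
          ‖(a m : ℚ_[p]) * (p : ℚ_[p]) ^ m - (b m : ℚ_[p]) * (p : ℚ_[p]) ^ m‖
            ≤ (p : ℝ) ^ (-(n + 1)) := by
        intro m hm
        rcases lt_or_gt_of_ne hm with h | h
        · rw [hn' m h, sub_self, norm_zero]; exact hpos.le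
        · rw [← sub_mul, norm_mul, Padic.norm_p_zpow, ← Int.cast_sub]
          refine (mul_le_of_le_one_left (by positivity) (Padic.norm_int_le_one _)).trans ?_
          exact zpow_le_zpow_right₀ hp1.le (by omega)
      have hev := (hs.eventually (Metric.ball_mem_nhds (0 : ℚ_[p]) hpos)).and
        (eventually_ge_atTop {n})
      obtain ⟨S, hS, hnS⟩ := hev.exists
      rw [dist_zero_right, ← Finset.add_sum_erase S _ (Finset.singleton_subset_iff.mp hnS)] at hS
      have h2 : ‖∑ m ∈ S.erase n,
          ((a m : ℚ_[p]) * (p : ℚ_[p]) ^ m - (b m : ℚ_[p]) * (p : ℚ_[p]) ^ m)‖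
            ≤ (p : ℝ) ^ (-(n + 1)) :=
        IsUltrametricDist.norm_sum_le_of_forall_le_of_nonneg hpos.le
          fun m hm => hterm m (Finset.ne_of_mem_erase hm)
      have h3 := (IsUltrametricDist.norm_add_le_max _ _).trans
        (max_le hS.le ((norm_neg _).le.trans h2))
      rw [← sub_eq_add_neg, add_sub_cancel_right, ← sub_mul, norm_mul, Padic.norm_p_zpow, ← Int.cast_sub,
        neg_add, zpow_add₀ (by positivity), mul_comm,
        mul_le_mul_iff_right₀ (by positivity)] at h3
      have h4 : ((p : ℤ) ^ 1) ∣ a n - b n := (Padic.norm_int_le_pow_iff_dvd _ 1).mp (by simpa using h3)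
      rw [pow_one] at h4
      have h5 := ha.digit_le n
      have h6 := hb.digit_le n
      have h7 := abs_sub (a n) (b n)
      have h8 := Int.eq_zero_of_abs_lt_dvd h4 (by omega)
      omega
  funext n
  exact key (n + max r r' + 1).toNat n (by omega)

/-- The balanced `p`-adic digits of `α` (for `p` odd). -/
noncomputable def balancedDigits (p : ℕ) [Fact p.Prime] (α : ℚ_[p]) : ℤ → ℤ :=
  Classical.epsilon (IsBalancedExpansion p α)

theorem isBalancedExpansion_balancedDigits (p : ℕ) [Fact p.Prime] (hp : p ≠ 2) (α : ℚ_[p]) :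
    IsBalancedExpansion p α (balancedDigits p α) :=
  Classical.epsilon_spec (exists_isBalancedExpansion p hp α)

/-- `s(α) = ∑_{n ≤ 0} aₙ pⁿ`, where `α = ∑ₙ aₙ pⁿ` is the balanced expansion
(only finitely many terms of the sum are non-zero). -/
noncomputable def floorS (p : ℕ) [Fact p.Prime] (α : ℚ_[p]) : ℚ :=
  ∑ᶠ n ∈ Set.Iic (0 : ℤ), (balancedDigits p α n : ℚ) * (p : ℚ) ^ n

/-- `t(α) = ∑_{n ≤ -1} aₙ pⁿ`, where `α = ∑ₙ aₙ pⁿ` is the balanced expansion. -/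
noncomputable def floorT (p : ℕ) [Fact p.Prime] (α : ℚ_[p]) : ℚ :=
  ∑ᶠ n ∈ Set.Iic (-1 : ℤ), (balancedDigits p α n : ℚ) * (p : ℚ) ^ n

open Classical in
/-- The partial quotient which Browkin's second algorithm assigns at step `n` to the complete
quotient `α`. The condition `v_p(α - t(α)) = 0` is written `‖α - t(α)‖ = 1`
(it fails for `α = t(α)`, in accordance with `v_p(0) = ∞`). -/
noncomputable def quotientAt (p : ℕ) [Fact p.Prime] (n : ℕ) (α : ℚ_[p]) : ℚ :=
  if Even n then floorS p α
  else if ‖α - (floorT p α : ℚ_[p])‖ = 1 then floorT p α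
  else floorT p α - (SignType.sign (floorT p α) : ℚ)

open Classical in
/-- The complete quotients of Browkin's second algorithm: `α₀ = α` and
`αₙ₊₁ = 1 / (αₙ - bₙ)`; the algorithm stops (value `none`) after step `n` if `αₙ = bₙ`. -/
noncomputable def completeQuotient (p : ℕ) [Fact p.Prime] (α : ℚ_[p]) : ℕ → Option ℚ_[p]
  | 0 => some α
  | n + 1 => (completeQuotient p α n).bind fun x =>
      if x = (quotientAt p n x : ℚ_[p]) then none
      else some (1 / (x - (quotientAt p n x : ℚ_[p])))

/-- The `n`-th partial quotient of the Browkin II expansion of `α` (`none` if the expansion has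
stopped before step `n`). -/
noncomputable def partialQuotient (p : ℕ) [Fact p.Prime] (α : ℚ_[p]) (n : ℕ) : Option ℚ :=
  (completeQuotient p α n).map (quotientAt p n)

/-- The Browkin II expansion of `α` is the infinite expansion `[b₀, b₁, b₂, …]`. -/
def HasExpansion (p : ℕ) [Fact p.Prime] (α : ℚ_[p]) (b : ℕ → ℚ) : Prop :=
  ∀ n, partialQuotient p α n = some (b n)

/-- The infinite continued fraction `b₀ + 1/(b₁ + 1/(b₂ + ⋯))` over `ℚ_p`. -/
noncomputable def contFract (p : ℕ) [Fact p.Prime] (b : ℕ → ℚ) : GenContFract ℚ_[p] :=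
  ⟨(b 0 : ℚ_[p]), Stream'.Seq.ofStream fun n => ⟨1, (b (n + 1) : ℚ_[p])⟩⟩

/-- The infinite continued fraction `[b₀, b₁, b₂, …]` has value `α` in `ℚ_p`: the denominators of
its convergents do not vanish and the convergents converge to `α`. -/
def HasValue (p : ℕ) [Fact p.Prime] (b : ℕ → ℚ) (α : ℚ_[p]) : Prop :=
  (∀ n, (contFract p b).dens n ≠ 0) ∧ Tendsto (contFract p b).convs atTop (𝓝 α)

/-- The sequence which runs through `pre` once and then repeats `block` forever. -/
def periodicSeq (pre block : List ℚ) (n : ℕ) : ℚ :=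
  if n < pre.length then pre.getD n 0
  else block.getD ((n - pre.length) % block.length) 0

/-- The sequence `b` is ultimately periodic and its (least) period length is `k`. -/
def HasPeriodLength (b : ℕ → ℚ) (k : ℕ) : Prop :=
  IsLeast {j : ℕ | 0 < j ∧ ∃ h, ∀ n, h ≤ n → b (n + j) = b n} k

/-- `D = p² (1 - pᵗ) / (1 - p)²`. -/
def radicand (p t : ℕ) : ℚ :=
  (p : ℚ) ^ 2 * (1 - (p : ℚ) ^ t) / (1 - (p : ℚ)) ^ 2

/-- The sequence `[0, ε/p, (-ε, -2ε(p^(t-1)-1)/((p-1)p^(t-1)), -ε, 2ε/p) repeated]`. -/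
def familySeq (p t : ℕ) (ε : ℚ) : ℕ → ℚ :=
  periodicSeq [0, ε / p]
    [-ε, -(2 * ε * ((p : ℚ) ^ (t - 1) - 1) / (((p : ℚ) - 1) * (p : ℚ) ^ (t - 1))), -ε, 2 * ε / p]

end BrowkinII

/-!
Let `u` be the square root of `1 - pᵗ` with `u ≡ 1`; Hensel's lemma gives `‖1 - u‖ = p⁻ᵗ`
(`exists_sq_eq_one_sub_pow`). The square root in question is `β = p u / (1 - p)`, and its complete
quotients can be written down in closed form (`familyQuotient`): after
`α₀ = p u / (1 - p)` and `α₁ = (1 - p) / (p u)` they run through the cycle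
`p u / (1 - p - u)`, `(pᵗ⁻¹ - (1 + u)) / ((1 - p) pᵗ⁻¹)`, `(1 - p) pᵗ⁻¹ / (1 - u - pᵗ⁻¹)`,
`(1 + u - p) / (p u)`. The relations `αₙ = bₙ + 1 / αₙ₊₁` are rational identities which follow from
`u² = 1 - pᵗ`, and the closeness of `u` to `1` shows that the complete quotients are units at even
positive indices and have norm at least `p` at odd indices (`isQuotientSeq_family`).

The remaining claims follow from these two facts for any such sequence.

* The denominators `Bₙ` of the convergents grow, because in their recurrence one summand
  always dominates, while `Bₙ α₀ - Aₙ` is a product of inverses of complete quotients up to sign and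
  hence bounded. This gives convergence (`IsQuotientSeq.hasValue`).
* `s(α)` and `t(α)` need not be computed from digits: by the product formula each of them is the
  only element of `ℤ[1/p]` which is close to `α` in the `p`-adic sense and small in the archimedean
  sense (`truncation_eq`). For `p ≥ 5` the given partial quotients are small enough, and so they are
  those of the algorithm (`IsQuotientSeq.hasExpansion`). The sign correction at odd steps never
  occurs, because `αₙ - bₙ = 1 / αₙ₊₁` is then a unit.

The case of `-β` follows by changing all signs. Finally `D_t` is an integer whenever `p - 1`
divides `t`, because `1 + p + ⋯ + pᵗ⁻¹ ≡ t` modulo `p - 1`.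
-/

namespace BrowkinII

/-! ### Truncations of the balanced expansion -/

/-- A geometric sum over a block of consecutive integer exponents. -/
lemma sum_Ico_mul_zpow {q : ℚ} (hq : q ≠ 0) (a : ℤ) (m : ℕ) :
    ∑ n ∈ Finset.Ico a (a + m), (q - 1) * q ^ n = q ^ (a + m) - q ^ a := by
  induction m with
  | zero => simp
  | succ m ih =>
    have h : Finset.Ico a (a + (m + 1 : ℕ)) = insert (a + m) (Finset.Ico a (a + m)) := by
      ext n; simp only [Finset.mem_Ico, Finset.mem_insert]; omega
    rw [h, Finset.sum_insert (by simp), ih]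
    push_cast
    rw [← add_assoc, zpow_add_one₀ hq]
    ring

/-- The part `∑_{n ≤ c} aₙ pⁿ` of the balanced expansion of `α`. -/
noncomputable def truncation (p : ℕ) [Fact p.Prime] (c : ℤ) (α : ℚ_[p]) : ℚ :=
  ∑ᶠ n ∈ Set.Iic c, (balancedDigits p α n : ℚ) * (p : ℚ) ^ n

lemma truncation_eq_sum_Ico {p : ℕ} [Fact p.Prime] (hp : p ≠ 2) (c : ℤ) (α : ℚ_[p]) :
    ∃ r : ℕ, (∀ n < -(r : ℤ), balancedDigits p α n = 0) ∧ truncation p c α =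
      ∑ n ∈ Finset.Ico (-(r : ℤ)) (-(r : ℤ) + (c + 1 + r).toNat),
        (balancedDigits p α n : ℚ) * (p : ℚ) ^ n := by
  obtain ⟨r, hr⟩ := (isBalancedExpansion_balancedDigits p hp α).eventually_zero
  have hr' : ∀ n < -(r.toNat : ℤ), balancedDigits p α n = 0 := fun n hn => hr n (by omega)
  refine ⟨r.toNat, hr', finsum_mem_eq_sum_of_inter_support_eq _ ?_⟩
  ext n
  simp only [Set.mem_inter_iff, Set.mem_Iic, Finset.coe_Ico, Set.mem_Ico, Function.mem_support]
  refine and_congr_left fun hn => ?_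
  have : -(r.toNat : ℤ) ≤ n := by
    by_contra! h
    exact hn (by simp [hr' n h])
  omega

/-- The truncation has archimedean absolute value less than `p ^ (c + 1) / 2`. -/
lemma abs_truncation_lt {p : ℕ} [Fact p.Prime] (hp : p ≠ 2) {c : ℤ} (hc : -1 ≤ c)
    (α : ℚ_[p]) : 2 * |truncation p c α| < (p : ℚ) ^ (c + 1) := by
  obtain ⟨r, -, hr⟩ := truncation_eq_sum_Ico hp c α
  have hp0 : (0 : ℚ) < p := by exact_mod_cast (Fact.out : p.Prime).pos
  have hle : 2 * |truncation p c α| ≤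
      ∑ n ∈ Finset.Ico (-(r : ℤ)) (-(r : ℤ) + (c + 1 + r).toNat), ((p : ℚ) - 1) * (p : ℚ) ^ n := by
    rw [hr]
    refine (mul_le_mul_of_nonneg_left (Finset.abs_sum_le_sum_abs _ _) zero_le_two).trans ?_
    rw [Finset.mul_sum]
    refine Finset.sum_le_sum fun n _ => ?_
    rw [abs_mul, abs_of_pos (zpow_pos hp0 n), ← mul_assoc]
    refine mul_le_mul_of_nonneg_right ?_ (zpow_pos hp0 n).le
    exact_mod_cast (isBalancedExpansion_balancedDigits p hp α).digit_le n
  rw [sum_Ico_mul_zpow hp0.ne'] at hle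
  rw [show -(r : ℤ) + ((c + 1 + r).toNat : ℤ) = c + 1 by omega] at hle
  linarith [zpow_pos hp0 (-(r : ℤ))]

lemma exists_truncation_mul_pow_eq_intCast {p : ℕ} [Fact p.Prime] (hp : p ≠ 2) (c : ℤ)
    (α : ℚ_[p]) : ∃ (r : ℕ) (N : ℤ), truncation p c α * (p : ℚ) ^ r = N := by
  obtain ⟨r, -, hr⟩ := truncation_eq_sum_Ico hp c α
  have hp0 : (p : ℚ) ≠ 0 := by exact_mod_cast (Fact.out : p.Prime).ne_zero
  refine ⟨r, ∑ n ∈ Finset.Ico (-(r : ℤ)) (-(r : ℤ) + (c + 1 + r).toNat),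
    balancedDigits p α n * (p : ℤ) ^ (n + r).toNat, ?_⟩
  rw [hr, Finset.sum_mul]
  push_cast
  refine Finset.sum_congr rfl fun n hn => ?_
  rw [Finset.mem_Ico] at hn
  rw [mul_assoc, ← zpow_natCast, ← zpow_natCast, ← zpow_add₀ hp0,
    show (((n + r).toNat : ℕ) : ℤ) = n + r by omega]

/-- The truncation approximates `α` up to `p ^ (c + 1)`. -/
lemma norm_sub_truncation_le {p : ℕ} [Fact p.Prime] (hp : p ≠ 2) (c : ℤ)
    (α : ℚ_[p]) : ‖α - (truncation p c α : ℚ_[p])‖ ≤ (p : ℝ) ^ (-(c + 1)) := by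
  obtain ⟨r, hr0, hr⟩ := truncation_eq_sum_Ico hp c α
  have hp1 : (1 : ℝ) < p := by exact_mod_cast (Fact.out : p.Prime).one_lt
  have hpos : (0 : ℝ) < (p : ℝ) ^ (-(c + 1)) := by positivity
  set T := Finset.Ico (-(r : ℤ)) (-(r : ℤ) + (c + 1 + r).toNat)
  -- compare with a finite partial sum over `S ⊇ T` that is already close to `α`; the terms outside
  -- `T` are divisible by `p ^ (c + 1)`
  have hev := ((isBalancedExpansion_balancedDigits p hp α).hasSum.eventually
    (Metric.ball_mem_nhds α hpos)).and (eventually_ge_atTop T)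
  obtain ⟨S, hS, hTS⟩ := hev.exists
  rw [dist_comm, dist_eq_norm] at hS
  have hrc : (truncation p c α : ℚ_[p]) =
      ∑ n ∈ T, (balancedDigits p α n : ℚ_[p]) * (p : ℚ_[p]) ^ n := by
    rw [hr]; push_cast; rfl
  have hdiff : ‖∑ n ∈ S \ T, (balancedDigits p α n : ℚ_[p]) * (p : ℚ_[p]) ^ n‖ ≤
      (p : ℝ) ^ (-(c + 1)) := by
    refine IsUltrametricDist.norm_sum_le_of_forall_le_of_nonneg hpos.le fun n hn => ?_
    rw [Finset.mem_sdiff, Finset.mem_Ico] at hn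
    by_cases h : n < -(r : ℤ)
    · rw [hr0 n h, Int.cast_zero, zero_mul, norm_zero]; exact hpos.le
    · rw [norm_mul, Padic.norm_p_zpow]
      refine (mul_le_of_le_one_left (by positivity) (Padic.norm_int_le_one _)).trans ?_
      exact zpow_le_zpow_right₀ hp1.le (by omega)
  rw [hrc, ← sub_add_sub_cancel α (∑ n ∈ S, (balancedDigits p α n : ℚ_[p]) * (p : ℚ_[p]) ^ n),
    ← Finset.sum_sdiff_eq_sub hTS]
  exact (IsUltrametricDist.norm_add_le_max _ _).trans (max_le hS.le hdiff)

/-- A rational with `p`-power denominator which is small both in the archimedean and in the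
`p`-adic absolute value vanishes (product formula). -/
lemma eq_zero_of_abs_lt_of_norm_le {p : ℕ} [Fact p.Prime] {c : ℤ} (hc : -1 ≤ c) {x : ℚ} {r : ℕ}
    {N : ℤ} (hN : x * (p : ℚ) ^ r = N) (habs : |x| < (p : ℚ) ^ (c + 1))
    (hnorm : ‖(x : ℚ_[p])‖ ≤ (p : ℝ) ^ (-(c + 1))) : x = 0 := by
  have hp0 : (0 : ℚ) < p := by exact_mod_cast (Fact.out : p.Prime).pos
  have hp0' : (0 : ℝ) < p := by exact_mod_cast (Fact.out : p.Prime).pos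
  obtain ⟨k, hk⟩ : ∃ k : ℕ, c + 1 = k := ⟨(c + 1).toNat, by omega⟩
  rw [hk] at habs hnorm
  have hdvd : ((p : ℤ) ^ (k + r)) ∣ N := by
    refine (Padic.norm_int_le_pow_iff_dvd (p := p) N (k + r)).mp ?_
    have : (N : ℚ_[p]) = (x : ℚ_[p]) * (p : ℚ_[p]) ^ r := by exact_mod_cast hN.symm
    rw [this, norm_mul, Padic.norm_p_pow]
    push_cast
    rw [neg_add, zpow_add₀ hp0'.ne']
    exact mul_le_mul_of_nonneg_right hnorm (by positivity)
  have hlt : |N| < (p : ℤ) ^ (k + r) := by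
    have : |(N : ℚ)| < (p : ℚ) ^ (k + r) := by
      rw [← hN, abs_mul, abs_of_pos (pow_pos hp0 r), pow_add]
      exact mul_lt_mul_of_pos_right (by simpa using habs) (pow_pos hp0 r)
    exact_mod_cast this
  have h0 := Int.eq_zero_of_abs_lt_dvd hdvd hlt
  rw [h0, Int.cast_zero] at hN
  exact (mul_eq_zero.mp hN).resolve_right (pow_ne_zero _ hp0.ne')

/-- The truncation is the only element of `ℤ[1/p]` of absolute value less than `p ^ (c + 1) / 2`
which approximates `α` up to `p ^ (c + 1)`; this computes it without the digits. -/
lemma truncation_eq {p : ℕ} [Fact p.Prime] (hp : p ≠ 2) {c : ℤ} (hc : -1 ≤ c) {α : ℚ_[p]} {s : ℚ}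
    {r : ℕ} {N : ℤ} (hN : s * (p : ℚ) ^ r = N) (habs : 2 * |s| < (p : ℚ) ^ (c + 1))
    (hnorm : ‖α - (s : ℚ_[p])‖ ≤ (p : ℝ) ^ (-(c + 1))) : truncation p c α = s := by
  obtain ⟨r', N', hN'⟩ := exists_truncation_mul_pow_eq_intCast hp c α
  have habs' := abs_truncation_lt hp hc α
  refine sub_eq_zero.mp (eq_zero_of_abs_lt_of_norm_le (p := p) hc (r := r' + r)
    (N := N' * (p : ℤ) ^ r - N * (p : ℤ) ^ r') ?_ ?_ ?_)
  · push_cast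
    rw [← hN, ← hN']; ring
  · linarith [abs_sub (truncation p c α) s]
  · have : ((truncation p c α - s : ℚ) : ℚ_[p]) =
        (α - (s : ℚ_[p])) - (α - (truncation p c α : ℚ_[p])) := by push_cast; ring
    rw [this, sub_eq_add_neg]
    refine (IsUltrametricDist.norm_add_le_max _ _).trans (max_le hnorm ?_)
    rw [norm_neg]
    exact norm_sub_truncation_le hp c α

lemma floorS_eq {p : ℕ} [Fact p.Prime] (hp : p ≠ 2) {α : ℚ_[p]} {s : ℚ} {r : ℕ} {N : ℤ}
    (hN : s * (p : ℚ) ^ r = N) (habs : 2 * |s| < p) (hnorm : ‖α - (s : ℚ_[p])‖ ≤ (p : ℝ)⁻¹) :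
    floorS p α = s :=
  truncation_eq hp (c := 0) (by norm_num) hN (by simpa using habs) (by simpa using hnorm)

lemma floorT_eq {p : ℕ} [Fact p.Prime] (hp : p ≠ 2) {α : ℚ_[p]} {s : ℚ} {r : ℕ} {N : ℤ}
    (hN : s * (p : ℚ) ^ r = N) (habs : 2 * |s| < 1) (hnorm : ‖α - (s : ℚ_[p])‖ ≤ 1) :
    floorT p α = s :=
  truncation_eq hp (c := -1) le_rfl hN (by simpa using habs) (by simpa using hnorm)

/-! ### Formal complete quotients -/

/-- `α` is a sequence of complete quotients for the continued fraction `[b₀, b₁, …]`, with the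
sizes typical of Browkin's second algorithm: units at even positive indices, non-integral numbers
at odd indices. -/
structure IsQuotientSeq (p : ℕ) [Fact p.Prime] (b : ℕ → ℚ) (α : ℕ → ℚ_[p]) : Prop where
  eq_add_inv : ∀ n, α n = (b n : ℚ_[p]) + (α (n + 1))⁻¹
  norm_odd : ∀ k, (p : ℝ) ≤ ‖α (2 * k + 1)‖
  norm_even : ∀ k, ‖α (2 * k + 2)‖ = 1

section IsQuotientSeq

variable {p : ℕ} [Fact p.Prime] {b : ℕ → ℚ} {α : ℕ → ℚ_[p]}

lemma IsQuotientSeq.one_lt_norm_odd (h : IsQuotientSeq p b α) (k : ℕ) :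
    1 < ‖α (2 * k + 1)‖ :=
  lt_of_lt_of_le (by exact_mod_cast (Fact.out : p.Prime).one_lt) (h.norm_odd k)

lemma IsQuotientSeq.one_le_norm (h : IsQuotientSeq p b α) (n : ℕ) : 1 ≤ ‖α (n + 1)‖ := by
  obtain ⟨k, rfl | rfl⟩ := n.even_or_odd'
  · exact (h.one_lt_norm_odd k).le
  · exact (h.norm_even k).ge

lemma IsQuotientSeq.ne_zero (h : IsQuotientSeq p b α) (n : ℕ) : α (n + 1) ≠ 0 :=
  norm_pos_iff.mp (zero_lt_one.trans_le (h.one_le_norm n))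

lemma IsQuotientSeq.sub_eq_inv (h : IsQuotientSeq p b α) (n : ℕ) :
    α n - (b n : ℚ_[p]) = (α (n + 1))⁻¹ := by
  rw [h.eq_add_inv n, add_sub_cancel_left]

lemma IsQuotientSeq.norm_partial_even (h : IsQuotientSeq p b α) (k : ℕ) :
    ‖(b (2 * k + 2) : ℚ_[p])‖ = 1 := by
  rw [← h.norm_even k]
  refine (Padic.norm_eq_of_norm_sub_lt_left ?_).symm
  rw [h.sub_eq_inv, norm_inv, h.norm_even]
  exact inv_lt_one_of_one_lt₀ (h.one_lt_norm_odd (k + 1))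

lemma IsQuotientSeq.le_norm_partial_odd (h : IsQuotientSeq p b α) (k : ℕ) :
    (p : ℝ) ≤ ‖(b (2 * k + 1) : ℚ_[p])‖ := by
  refine (h.norm_odd k).trans_eq (Padic.norm_eq_of_norm_sub_lt_left ?_)
  rw [h.sub_eq_inv, norm_inv, h.norm_even, inv_one]
  exact h.one_lt_norm_odd k

lemma dens_zero : (contFract p b).dens 0 = 1 := GenContFract.zeroth_den_eq_one

lemma nums_zero : (contFract p b).nums 0 = b 0 := GenContFract.zeroth_num_eq_h

lemma dens_one : (contFract p b).dens 1 = b 1 :=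
  GenContFract.first_den_eq (g := contFract p b) (gp := ⟨1, (b 1 : ℚ_[p])⟩) rfl

lemma nums_one : (contFract p b).nums 1 = b 1 * b 0 + 1 :=
  GenContFract.first_num_eq (g := contFract p b) (gp := ⟨1, (b 1 : ℚ_[p])⟩) rfl

lemma dens_add_two (n : ℕ) : (contFract p b).dens (n + 2) =
    b (n + 2) * (contFract p b).dens (n + 1) + (contFract p b).dens n := by
  have h := GenContFract.dens_recurrence (g := contFract p b) (n := n)
    (gp := ⟨1, (b (n + 2) : ℚ_[p])⟩) rfl rfl rfl
  simpa using h

lemma nums_add_two (n : ℕ) : (contFract p b).nums (n + 2) =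
    b (n + 2) * (contFract p b).nums (n + 1) + (contFract p b).nums n := by
  have h := GenContFract.nums_recurrence (g := contFract p b) (n := n)
    (gp := ⟨1, (b (n + 2) : ℚ_[p])⟩) rfl rfl rfl
  simpa using h

lemma norm_add_of_lt {x y : ℚ_[p]} (h : ‖y‖ < ‖x‖) : ‖x + y‖ = ‖x‖ := by
  rw [Padic.add_eq_max_of_ne h.ne', max_eq_left h.le]

lemma IsQuotientSeq.norm_dens_even_succ (h : IsQuotientSeq p b α) {k : ℕ}
    (hlt : ‖(contFract p b).dens (2 * k)‖ < ‖(contFract p b).dens (2 * k + 1)‖) :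
    ‖(contFract p b).dens (2 * k + 2)‖ = ‖(contFract p b).dens (2 * k + 1)‖ := by
  have e : ‖(b (2 * k + 2) : ℚ_[p]) * (contFract p b).dens (2 * k + 1)‖ =
      ‖(contFract p b).dens (2 * k + 1)‖ := by
    rw [norm_mul, h.norm_partial_even, one_mul]
  rw [dens_add_two, norm_add_of_lt (hlt.trans_eq e.symm), e]

/-- At odd indices the partial quotient is large and the two preceding denominators have the same
size, so the norm of the denominators grows at least by the factor `p`. -/
lemma IsQuotientSeq.norm_dens_odd (h : IsQuotientSeq p b α) (k : ℕ) :
    ‖(contFract p b).dens (2 * k)‖ < ‖(contFract p b).dens (2 * k + 1)‖ ∧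
      (p : ℝ) ^ (k + 1) ≤ ‖(contFract p b).dens (2 * k + 1)‖ := by
  have hp1 : (1 : ℝ) < p := by exact_mod_cast (Fact.out : p.Prime).one_lt
  induction k with
  | zero =>
    have h1 := h.le_norm_partial_odd 0
    simp only [mul_zero, zero_add, dens_zero, dens_one, norm_one, pow_one] at h1 ⊢
    exact ⟨hp1.trans_le h1, h1⟩
  | succ k ih =>
    obtain ⟨hlt, hle⟩ := ih
    have e := h.norm_dens_even_succ hlt
    have hpos : 0 < ‖(contFract p b).dens (2 * k + 1)‖ := (norm_nonneg _).trans_lt hlt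
    have h2 : (p : ℝ) * ‖(contFract p b).dens (2 * k + 1)‖ ≤
        ‖(b (2 * k + 3) : ℚ_[p]) * (contFract p b).dens (2 * k + 2)‖ := by
      rw [norm_mul, e]
      exact mul_le_mul_of_nonneg_right (h.le_norm_partial_odd (k + 1)) hpos.le
    have h3 : ‖(contFract p b).dens (2 * k + 1)‖ < p * ‖(contFract p b).dens (2 * k + 1)‖ :=
      lt_mul_of_one_lt_left hpos hp1
    have h4 : ‖(contFract p b).dens (2 * k + 3)‖ =
        ‖(b (2 * k + 3) : ℚ_[p]) * (contFract p b).dens (2 * k + 2)‖ := by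
      rw [dens_add_two, norm_add_of_lt (h3.trans_le h2)]
    rw [show 2 * (k + 1) = 2 * k + 2 by ring, h4, e]
    refine ⟨h3.trans_le h2, le_trans ?_ h2⟩
    rw [pow_succ']
    exact mul_le_mul_of_nonneg_left hle (by positivity)

lemma IsQuotientSeq.pow_le_norm_dens (h : IsQuotientSeq p b α) (n : ℕ) :
    (p : ℝ) ^ (n / 2) ≤ ‖(contFract p b).dens n‖ := by
  have hp1 : (1 : ℝ) < p := by exact_mod_cast (Fact.out : p.Prime).one_lt
  obtain ⟨k, rfl | rfl⟩ := n.even_or_odd'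
  · rw [Nat.mul_div_cancel_left _ two_pos]
    cases k with
    | zero => simp
    | succ k =>
      rw [show 2 * (k + 1) = 2 * k + 2 by ring, h.norm_dens_even_succ (h.norm_dens_odd k).1]
      exact (h.norm_dens_odd k).2
  · rw [show (2 * k + 1) / 2 = k by omega]
    exact (pow_le_pow_right₀ hp1.le k.le_succ).trans (h.norm_dens_odd k).2

/-- The errors `Bₙ α₀ - Aₙ` satisfy the recurrence of the continuants, so each is minus the
previous one divided by a complete quotient. -/
lemma IsQuotientSeq.error_succ (h : IsQuotientSeq p b α) (n : ℕ) :
    ((contFract p b).dens (n + 1) * α 0 - (contFract p b).nums (n + 1)) * α (n + 2) =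
      -((contFract p b).dens n * α 0 - (contFract p b).nums n) := by
  have key : ∀ n, α n * α (n + 1) = b n * α (n + 1) + 1 := fun n => by
    conv_lhs => rw [h.eq_add_inv n, add_mul, inv_mul_cancel₀ (h.ne_zero n)]
  induction n with
  | zero =>
    rw [zero_add, dens_one, nums_one, dens_zero, nums_zero]
    have h0 := key 0
    have h1 := key 1
    have hne := h.ne_zero 0
    simp only [zero_add] at h0 h1 hne ⊢
    apply mul_left_cancel₀ hne
    linear_combination (b 1 * α 2 + 1 : ℚ_[p]) * h0 - h1
  | succ n ih =>
    rw [dens_add_two, nums_add_two]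
    have h2 := key (n + 2)
    linear_combination α (n + 3) * ih -
      ((contFract p b).dens (n + 1) * α 0 - (contFract p b).nums (n + 1)) * h2

lemma IsQuotientSeq.norm_error_le (h : IsQuotientSeq p b α) (n : ℕ) :
    ‖(contFract p b).dens n * α 0 - (contFract p b).nums n‖ ≤ 1 := by
  induction n with
  | zero =>
    rw [dens_zero, nums_zero, one_mul, h.sub_eq_inv, norm_inv]
    exact inv_le_one_of_one_le₀ (h.one_le_norm 0)
  | succ n ih =>
    rw [← norm_neg, ← h.error_succ n, norm_mul] at ih
    exact (le_mul_of_one_le_right (norm_nonneg _) (h.one_le_norm (n + 1))).trans ih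

/-- The denominators tend to infinity while `Bₙ α₀ - Aₙ` stays bounded, so the continued fraction
converges to `α₀`. -/
theorem IsQuotientSeq.hasValue (h : IsQuotientSeq p b α) : HasValue p b (α 0) := by
  have hp1 : (1 : ℝ) < p := by exact_mod_cast (Fact.out : p.Prime).one_lt
  have hpos : ∀ n, 0 < ‖(contFract p b).dens n‖ := fun n =>
    (by positivity : (0 : ℝ) < (p : ℝ) ^ (n / 2)).trans_le (h.pow_le_norm_dens n)
  refine ⟨fun n => norm_pos_iff.mp (hpos n), ?_⟩
  refine tendsto_iff_norm_sub_tendsto_zero.mpr ?_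
  have hlim : Tendsto (fun n : ℕ => ((p : ℝ)⁻¹) ^ (n / 2)) atTop (𝓝 0) :=
    (tendsto_pow_atTop_nhds_zero_of_lt_one (by positivity) (inv_lt_one_of_one_lt₀ hp1)).comp
      (Nat.tendsto_div_const_atTop two_ne_zero)
  refine squeeze_zero (fun _ => norm_nonneg _) (fun n => ?_) hlim
  have e : (contFract p b).convs n - α 0 =
      -((contFract p b).dens n * α 0 - (contFract p b).nums n) / (contFract p b).dens n := by
    rw [GenContFract.conv_eq_num_div_den]
    have := norm_pos_iff.mp (hpos n)
    field_simp
    ring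
  rw [e, norm_div, norm_neg, inv_pow, ← one_div]
  exact div_le_div₀ zero_le_one (h.norm_error_le n) (by positivity) (h.pow_le_norm_dens n)

lemma IsQuotientSeq.quotientAt_eq (h : IsQuotientSeq p b α) (hp : p ≠ 2)
    (hint : ∀ n, ∃ (r : ℕ) (N : ℤ), b n * (p : ℚ) ^ r = N)
    (heven : ∀ n, Even n → 2 * |b n| < p) (hodd : ∀ n, Odd n → 2 * |b n| < 1) (n : ℕ) :
    quotientAt p n (α n) = b n := by
  obtain ⟨r, N, hN⟩ := hint n
  obtain ⟨k, rfl | rfl⟩ := n.even_or_odd'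
  · have hk : Even (2 * k) := even_two_mul k
    rw [quotientAt, if_pos hk]
    refine floorS_eq hp hN (heven _ hk) ?_
    rw [h.sub_eq_inv, norm_inv]
    exact inv_anti₀ (by exact_mod_cast (Fact.out : p.Prime).pos) (h.norm_odd k)
  · have hk : Odd (2 * k + 1) := odd_two_mul_add_one k
    have hnorm : ‖α (2 * k + 1) - (b (2 * k + 1) : ℚ_[p])‖ = 1 := by
      rw [h.sub_eq_inv, norm_inv, h.norm_even, inv_one]
    have hT := floorT_eq hp hN (hodd _ hk) hnorm.le
    rw [quotientAt, if_neg (Nat.not_even_iff_odd.mpr hk), hT, if_pos hnorm]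

/-- If the partial quotients lie in `ℤ[1/p]` and are small enough to be values of the two floor
functions, the algorithm produces exactly the given complete quotients. -/
theorem IsQuotientSeq.hasExpansion (h : IsQuotientSeq p b α) (hp : p ≠ 2)
    (hint : ∀ n, ∃ (r : ℕ) (N : ℤ), b n * (p : ℚ) ^ r = N)
    (heven : ∀ n, Even n → 2 * |b n| < p) (hodd : ∀ n, Odd n → 2 * |b n| < 1) :
    HasExpansion p (α 0) b := by
  have hq := h.quotientAt_eq hp hint heven hodd
  have hc : ∀ n, completeQuotient p (α 0) n = some (α n) := by
    intro n
    induction n with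
    | zero => rfl
    | succ n ih =>
      have hne : α n ≠ (b n : ℚ_[p]) := by
        rw [← sub_ne_zero, h.sub_eq_inv]
        exact inv_ne_zero (h.ne_zero n)
      rw [completeQuotient, ih, Option.bind_some, hq n, if_neg hne, h.sub_eq_inv, one_div, inv_inv]
  intro n
  rw [partialQuotient, hc n, Option.map_some, hq n]

end IsQuotientSeq

/-- Multiplying all partial and complete quotients by the same sign. -/
lemma IsQuotientSeq.const_mul {p : ℕ} [Fact p.Prime] {b : ℕ → ℚ} {α : ℕ → ℚ_[p]}
    (h : IsQuotientSeq p b α) {ε : ℚ} (hε : ε = 1 ∨ ε = -1) :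
    IsQuotientSeq p (fun n => ε * b n) fun n => (ε : ℚ_[p]) * α n := by
  rcases hε with rfl | rfl
  · simpa using h
  · refine ⟨fun n => ?_, fun k => ?_, fun k => ?_⟩
    · rw [h.eq_add_inv n]
      push_cast
      rw [mul_inv, inv_neg, inv_one]
      ring
    · simpa using h.norm_odd k
    · simpa using h.norm_even k

/-! ### The family of continued fractions -/

section familySeq

variable {p t : ℕ} {ε : ℚ}

lemma familySeq_zero : familySeq p t ε 0 = 0 := rfl

lemma familySeq_one : familySeq p t ε 1 = ε / p := rfl

lemma familySeq_add_two (n : ℕ) : familySeq p t ε (n + 2) =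
    [-ε, -(2 * ε * ((p : ℚ) ^ (t - 1) - 1) / (((p : ℚ) - 1) * (p : ℚ) ^ (t - 1))), -ε,
      2 * ε / p].getD (n % 4) 0 := by
  simp [familySeq, periodicSeq]

lemma familySeq_eq_mul (n : ℕ) : familySeq p t ε n = ε * familySeq p t 1 n := by
  match n with
  | 0 => simp [familySeq_zero]
  | 1 => simp [familySeq_one, div_eq_mul_inv]
  | n + 2 =>
    rw [familySeq_add_two, familySeq_add_two]
    have h : n % 4 < 4 := Nat.mod_lt _ (by norm_num)
    interval_cases n % 4 <;> simp <;> ring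

lemma familySeq_of_even {n : ℕ} (hn : Even n) :
    familySeq p t ε n = 0 ∨ familySeq p t ε n = -ε := by
  obtain ⟨k, rfl⟩ := hn.two_dvd
  cases k with
  | zero => exact .inl rfl
  | succ k =>
    rw [show 2 * (k + 1) = 2 * k + 2 by ring, familySeq_add_two]
    have h : 2 * k % 4 = 0 ∨ 2 * k % 4 = 2 := by omega
    rcases h with h | h <;> rw [h] <;> exact .inr rfl

lemma familySeq_of_odd {n : ℕ} (hn : Odd n) :
    familySeq p t ε n = ε / p ∨ familySeq p t ε n = 2 * ε / p ∨ familySeq p t ε n =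
      -(2 * ε * ((p : ℚ) ^ (t - 1) - 1) / (((p : ℚ) - 1) * (p : ℚ) ^ (t - 1))) := by
  obtain ⟨k, rfl⟩ := hn
  cases k with
  | zero => exact .inl rfl
  | succ k =>
    rw [show 2 * (k + 1) + 1 = 2 * k + 1 + 2 by ring, familySeq_add_two]
    have h : (2 * k + 1) % 4 = 1 ∨ (2 * k + 1) % 4 = 3 := by omega
    rcases h with h | h <;> rw [h]
    · exact .inr (.inr rfl)
    · exact .inr (.inl rfl)

/-- The partial quotients at odd places of the block have opposite signs, and are different from
those at even places, so the period is not shorter than the block. -/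
lemma hasPeriodLength_familySeq (hp : 3 ≤ p) (ht : 2 ≤ t) (hε : ε ≠ 0) :
    HasPeriodLength (familySeq p t ε) 4 := by
  have hp1 : (1 : ℚ) < p := by exact_mod_cast (by omega : 1 < p)
  refine ⟨⟨by norm_num, 2, fun n hn => ?_⟩, ?_⟩
  · obtain ⟨m, rfl⟩ := Nat.exists_eq_add_of_le' hn
    rw [show m + 2 + 4 = m + 4 + 2 by ring, familySeq_add_two, familySeq_add_two,
      Nat.add_mod_right]
  · rintro j ⟨hj, h, hper⟩
    by_contra! hlt
    -- beyond any pre-period there is an index `4 h + 5` with partial quotient `2 ε / p`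
    have h0 := hper (4 * h + 5) (by omega)
    rw [show 4 * h + 5 + j = 4 * h + 3 + j + 2 by ring, show 4 * h + 5 = 4 * h + 3 + 2 by ring,
      familySeq_add_two, familySeq_add_two, show (4 * h + 3) % 4 = 3 by omega] at h0
    have hodd : -ε ≠ 2 * ε / p := by
      intro he
      field_simp at he
      linarith
    interval_cases j
    · rw [show (4 * h + 3 + 1) % 4 = 0 by omega] at h0
      exact hodd (by simpa using h0)
    · rw [show (4 * h + 3 + 2) % 4 = 1 by omega] at h0
      have hQ : (1 : ℚ) < (p : ℚ) ^ (t - 1) := one_lt_pow₀ hp1 (by omega)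
      have hc : 0 < ((p : ℚ) ^ (t - 1) - 1) / (((p : ℚ) - 1) * (p : ℚ) ^ (t - 1)) :=
        div_pos (by linarith) (mul_pos (by linarith) (by linarith))
      have h1 : ε * (((p : ℚ) ^ (t - 1) - 1) / (((p : ℚ) - 1) * (p : ℚ) ^ (t - 1)) + 1 / p) = 0 := by
        simp only [List.getD_cons_succ, List.getD_cons_zero] at h0
        linear_combination (-1 / 2 : ℚ) * h0
      have h2 : 0 < 1 / (p : ℚ) := by positivity
      exact (mul_ne_zero hε (by linarith)) h1
    · rw [show (4 * h + 3 + 3) % 4 = 2 by omega] at h0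
      exact hodd (by simpa using h0)

lemma exists_familySeq_mul_pow_eq_intCast (hp : 2 ≤ p) (hε : ε = 1 ∨ ε = -1) (n : ℕ) :
    ∃ (r : ℕ) (N : ℤ), familySeq p t ε n * (p : ℚ) ^ r = N := by
  have hp1 : (1 : ℚ) < p := by exact_mod_cast hp
  obtain ⟨e, rfl⟩ : ∃ e : ℤ, ε = e := by
    rcases hε with rfl | rfl
    exacts [⟨1, by simp⟩, ⟨-1, by simp⟩]
  rcases n.even_or_odd with hn | hn
  · rcases familySeq_of_even (p := p) (t := t) (ε := e) hn with h | h
    · exact ⟨0, 0, by simp [h]⟩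
    · exact ⟨0, -e, by simp [h]⟩
  · rcases familySeq_of_odd (p := p) (t := t) (ε := e) hn with h | h | h
    · exact ⟨1, e, by rw [h]; field_simp⟩
    · exact ⟨1, 2 * e, by rw [h]; push_cast; field_simp⟩
    · refine ⟨t - 1, -(2 * e * ∑ i ∈ Finset.range (t - 1), (p : ℤ) ^ i), ?_⟩
      have hg := mul_geom_sum (p : ℚ) (t - 1)
      have : (p : ℚ) - 1 ≠ 0 := by linarith
      rw [h]
      push_cast
      rw [← hg]
      field_simp

lemma two_mul_abs_familySeq_of_even_lt (hp : 3 ≤ p) (hε : |ε| = 1) {n : ℕ} (hn : Even n) :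
    2 * |familySeq p t ε n| < p := by
  have hp3 : (3 : ℚ) ≤ p := by exact_mod_cast hp
  rcases familySeq_of_even (p := p) (t := t) (ε := ε) hn with h | h
  · rw [h, abs_zero]; linarith
  · rw [h, abs_neg, hε]; linarith

lemma two_mul_abs_familySeq_of_odd_lt (hp : 5 ≤ p) (hε : |ε| = 1) {n : ℕ} (hn : Odd n) :
    2 * |familySeq p t ε n| < 1 := by
  have hp5 : (5 : ℚ) ≤ p := by exact_mod_cast hp
  have hp0 : |(p : ℚ)| = p := abs_of_pos (by linarith)
  rcases familySeq_of_odd (p := p) (t := t) (ε := ε) hn with h | h | h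
  · rw [h, abs_div, hε, hp0, mul_one_div, div_lt_one (by linarith)]
    linarith
  · rw [h, abs_div, abs_mul, hε, hp0, abs_two, mul_one, mul_div, div_lt_one (by linarith)]
    linarith
  · have hQ : (1 : ℚ) ≤ (p : ℚ) ^ (t - 1) := one_le_pow₀ (by linarith)
    have hden : 0 < ((p : ℚ) - 1) * (p : ℚ) ^ (t - 1) := mul_pos (by linarith) (by linarith)
    rw [h, abs_neg, abs_div, abs_mul, abs_mul, hε, abs_two, mul_one,
      abs_of_nonneg (by linarith : 0 ≤ (p : ℚ) ^ (t - 1) - 1), abs_of_pos hden, mul_div,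
      div_lt_one hden]
    nlinarith

end familySeq

/-! ### The complete quotients of the family -/

/-- Since `1 - pᵗ` is close to `1`, it has a square root close to `1`. -/
lemma exists_sq_eq_one_sub_pow {p : ℕ} [Fact p.Prime] (hp : p ≠ 2) {t : ℕ} (ht : t ≠ 0) :
    ∃ u : ℚ_[p], u ^ 2 = 1 - (p : ℚ_[p]) ^ t ∧ ‖1 - u‖ = ((p : ℝ) ^ t)⁻¹ := by
  have hp1 : (1 : ℝ) < p := by exact_mod_cast (Fact.out : p.Prime).one_lt
  have h2 : ‖(2 : ℚ_[p])‖ = 1 := by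
    simpa using (Padic.norm_natCast_eq_one_iff (p := p) (n := 2)).mpr
      ((Nat.coprime_primes Fact.out Nat.prime_two).mpr hp)
  have h2' : ‖(2 : ℤ_[p])‖ = 1 := by
    rw [PadicInt.norm_def]; exact_mod_cast h2
  have hpt : ‖(p : ℤ_[p]) ^ t‖ < 1 := by
    rw [norm_pow, PadicInt.norm_p]
    exact pow_lt_one₀ (by positivity) (inv_lt_one_of_one_lt₀ hp1) ht
  obtain ⟨c, hc⟩ : ∃ c : ℤ_[p], c = 1 - (p : ℤ_[p]) ^ t := ⟨_, rfl⟩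
  have hF : (Polynomial.X ^ 2 - Polynomial.C c).derivative.aeval (1 : ℤ_[p]) = 2 := by
    simp [one_add_one_eq_two]
  obtain ⟨z, hz, hz1, -⟩ := hensels_lemma (p := p) (R := ℤ_[p])
    (F := Polynomial.X ^ 2 - Polynomial.C c) (a := 1) (by
      rw [hF, h2', one_pow]
      simpa [hc] using hpt)
  rw [hF, h2'] at hz1
  have hz' : z ^ 2 = 1 - (p : ℤ_[p]) ^ t := by
    simpa [sub_eq_zero, hc] using hz
  have hz2 : ‖(z : ℚ_[p]) - 1‖ < 1 := by
    rw [PadicInt.norm_def] at hz1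
    exact_mod_cast hz1
  have hu : (z : ℚ_[p]) ^ 2 = 1 - (p : ℚ_[p]) ^ t := by
    exact_mod_cast congrArg ((↑) : ℤ_[p] → ℚ_[p]) hz'
  refine ⟨z, hu, ?_⟩
  have h1 : ‖1 + (z : ℚ_[p])‖ = 1 := by
    rw [show 1 + (z : ℚ_[p]) = 2 + (z - 1) by ring, norm_add_of_lt (hz2.trans_eq h2.symm), h2]
  have h3 : (1 - (z : ℚ_[p])) * (1 + z) = (p : ℚ_[p]) ^ t := by linear_combination -hu
  have h4 := congrArg norm h3
  rwa [norm_mul, h1, mul_one, norm_pow, Padic.norm_p, inv_pow] at h4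

/-- The complete quotients of `p u / (1 - p)`, where `u² = 1 - pᵗ` and `u` is close to `1`: two
initial terms, and then a cycle of length `4`. -/
noncomputable def familyQuotient (p t : ℕ) [Fact p.Prime] (u : ℚ_[p]) : ℕ → ℚ_[p]
  | 0 => p * u / (1 - p)
  | 1 => (1 - p) / (p * u)
  | n + 2 => [p * u / (1 - p - u),
      ((p : ℚ_[p]) ^ (t - 1) - (1 + u)) / ((1 - p) * (p : ℚ_[p]) ^ (t - 1)),
      (1 - p) * (p : ℚ_[p]) ^ (t - 1) / (1 - u - (p : ℚ_[p]) ^ (t - 1)),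
      (1 + u - p) / (p * u)].getD (n % 4) 0

section familyQuotient

variable {p t : ℕ} [Fact p.Prime] {u : ℚ_[p]}

lemma isQuotientSeq_family (hp : p ≠ 2) (ht : 2 ≤ t) (hu : u ^ 2 = 1 - (p : ℚ_[p]) ^ t)
    (hu1 : ‖1 - u‖ = ((p : ℝ) ^ t)⁻¹) :
    IsQuotientSeq p (familySeq p t 1) (familyQuotient p t u) := by
  have hp1 : (1 : ℝ) < p := by exact_mod_cast (Fact.out : p.Prime).one_lt
  have hp0 : (p : ℚ_[p]) ≠ 0 := by exact_mod_cast (Fact.out : p.Prime).ne_zero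
  have h2 : ‖(2 : ℚ_[p])‖ = 1 := by
    simpa using (Padic.norm_natCast_eq_one_iff (p := p) (n := 2)).mpr
      ((Nat.coprime_primes Fact.out Nat.prime_two).mpr hp)
  have hnp : ‖(p : ℚ_[p])‖ = (p : ℝ)⁻¹ := Padic.norm_p
  have hpi : (p : ℝ)⁻¹ < 1 := inv_lt_one_of_one_lt₀ hp1
  have hQ : ‖(p : ℚ_[p]) ^ (t - 1)‖ = ((p : ℝ) ^ (t - 1))⁻¹ := by rw [norm_pow, hnp, inv_pow]
  have hQp : (p : ℝ) ≤ (p : ℝ) ^ (t - 1) := le_self_pow₀ hp1.le (by omega)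
  have hQ1 : ((p : ℝ) ^ (t - 1))⁻¹ ≤ (p : ℝ)⁻¹ := inv_anti₀ (by positivity) hQp
  have huQ : ‖1 - u‖ < ((p : ℝ) ^ (t - 1))⁻¹ := by
    rw [hu1]
    exact inv_strictAnti₀ (by positivity) (pow_lt_pow_right₀ hp1 (by omega))
  have hsplit : (p : ℚ_[p]) ^ t = p * (p : ℚ_[p]) ^ (t - 1) := by
    rw [← pow_succ', show t - 1 + 1 = t by omega]
  -- the `p`-adic sizes of all factors occurring in the complete quotients
  have n1 : ‖1 - (p : ℚ_[p])‖ = 1 := by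
    rw [sub_eq_add_neg, norm_add_of_lt (by rwa [norm_neg, norm_one, hnp]), norm_one]
  have n2 : ‖u‖ = 1 := by
    rw [show u = 1 + -(1 - u) by ring, norm_add_of_lt (by rw [norm_neg, norm_one]; linarith),
      norm_one]
  have n3 : ‖1 - p - u‖ = (p : ℝ)⁻¹ := by
    rw [show 1 - p - u = -(p : ℚ_[p]) + (1 - u) by ring,
      norm_add_of_lt (by rw [norm_neg, hnp]; linarith), norm_neg, hnp]
  have n4 : ‖(p : ℚ_[p]) ^ (t - 1) - (1 + u)‖ = 1 := by
    have h : ‖(p : ℚ_[p]) ^ (t - 1) + (1 - u)‖ < 1 :=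
      (IsUltrametricDist.norm_add_le_max _ _).trans_lt
        (max_lt (by rw [hQ]; linarith) (by linarith))
    rw [show (p : ℚ_[p]) ^ (t - 1) - (1 + u) = -2 + ((p : ℚ_[p]) ^ (t - 1) + (1 - u)) by ring,
      norm_add_of_lt (by rwa [norm_neg, h2]), norm_neg, h2]
  have n5 : ‖1 - u - (p : ℚ_[p]) ^ (t - 1)‖ = ((p : ℝ) ^ (t - 1))⁻¹ := by
    rw [sub_eq_neg_add, norm_add_of_lt (by rwa [norm_neg, hQ]), norm_neg, hQ]
  have n6 : ‖1 + u - p‖ = 1 := by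
    have h : ‖-(1 - u) + -(p : ℚ_[p])‖ < 1 :=
      (IsUltrametricDist.norm_add_le_max _ _).trans_lt
        (max_lt (by rw [norm_neg]; linarith) (by rwa [norm_neg, hnp]))
    rw [show 1 + u - p = 2 + (-(1 - u) + -(p : ℚ_[p])) by ring,
      norm_add_of_lt (h.trans_eq h2.symm), h2]
  have z1 : 1 - (p : ℚ_[p]) ≠ 0 := norm_ne_zero_iff.mp (by rw [n1]; exact one_ne_zero)
  have z1' : (p : ℚ_[p]) - 1 ≠ 0 := by rw [← neg_sub]; exact neg_ne_zero.mpr z1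
  have z2 : u ≠ 0 := norm_ne_zero_iff.mp (by rw [n2]; exact one_ne_zero)
  have z3 : 1 - p - u ≠ 0 := norm_ne_zero_iff.mp (by rw [n3]; positivity)
  have z4 : (p : ℚ_[p]) ^ (t - 1) - (1 + u) ≠ 0 :=
    norm_ne_zero_iff.mp (by rw [n4]; exact one_ne_zero)
  have z5 : 1 - u - (p : ℚ_[p]) ^ (t - 1) ≠ 0 := norm_ne_zero_iff.mp (by rw [n5]; positivity)
  have z6 : 1 + u - p ≠ 0 := norm_ne_zero_iff.mp (by rw [n6]; exact one_ne_zero)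
  have zQ : (p : ℚ_[p]) ^ (t - 1) ≠ 0 := pow_ne_zero _ hp0
  rw [hsplit] at hu
  have hQpos : (0 : ℝ) < (p : ℝ) ^ (t - 1) := by positivity
  refine ⟨fun n => ?_, fun k => ?_, fun k => ?_⟩
  · match n with
    | 0 => simp [familyQuotient, familySeq_zero]
    | 1 =>
      simp only [familyQuotient, familySeq_one, Nat.zero_mod, List.getD_cons_zero, inv_div]
      push_cast
      field_simp
      ring
    | n + 2 =>
      rw [familySeq_add_two, familyQuotient, familyQuotient]
      have h : n % 4 = 0 ∨ n % 4 = 1 ∨ n % 4 = 2 ∨ n % 4 = 3 := by omega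
      rcases h with h | h | h | h
      · rw [h, show (n + 1) % 4 = 1 by omega]
        simp only [List.getD_cons_succ, List.getD_cons_zero, inv_div]
        push_cast
        rw [← sub_eq_zero]
        field_simp
        generalize (p : ℚ_[p]) ^ (t - 1) = Q at *
        linear_combination (1 - p : ℚ_[p]) * hu
      · rw [h, show (n + 1) % 4 = 2 by omega]
        simp only [List.getD_cons_succ, List.getD_cons_zero, inv_div]
        push_cast
        rw [← neg_sub 1 (p : ℚ_[p])]
        field_simp
        ring
      · rw [h, show (n + 1) % 4 = 3 by omega]
        simp only [List.getD_cons_succ, List.getD_cons_zero, inv_div]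
        push_cast
        field_simp
        generalize (p : ℚ_[p]) ^ (t - 1) = Q at *
        linear_combination (p - 1 : ℚ_[p]) * hu
      · rw [h, show (n + 1) % 4 = 0 by omega]
        simp only [List.getD_cons_succ, List.getD_cons_zero, inv_div]
        push_cast
        field_simp
        ring
  · cases k with
    | zero => simp [familyQuotient, n1, n2]
    | succ k =>
      rw [show 2 * (k + 1) + 1 = 2 * k + 1 + 2 by ring, familyQuotient]
      have h : (2 * k + 1) % 4 = 1 ∨ (2 * k + 1) % 4 = 3 := by omega
      rcases h with h | h <;> rw [h] <;>
        simp only [List.getD_cons_succ, List.getD_cons_zero, norm_div, norm_mul]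
      · rw [n4, n1, hQ, one_mul, one_div, inv_inv]
        exact hQp
      · rw [n6, n2, hnp, mul_one, one_div, inv_inv]
  · rw [familyQuotient]
    have h : (2 * k) % 4 = 0 ∨ (2 * k) % 4 = 2 := by omega
    rcases h with h | h <;> rw [h] <;>
      simp only [List.getD_cons_succ, List.getD_cons_zero, norm_div, norm_mul]
    · rw [hnp, n2, n3, mul_one, div_self (by positivity)]
    · rw [n1, hQ, n5, one_mul, div_self (by positivity)]

end familyQuotient

/-! ### Integrality of the radicand -/

/-- `p - 1` divides `1 + p + ⋯ + p ^ (t - 1)` as soon as it divides `t`. -/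
lemma exists_intCast_eq_radicand {p : ℕ} (hp : 2 ≤ p) {t : ℕ} (ht : p - 1 ∣ t) :
    ∃ m : ℤ, (m : ℚ) = radicand p t := by
  have hp1 : (p : ℚ) - 1 ≠ 0 := by
    have : (1 : ℚ) < p := by exact_mod_cast hp
    linarith
  have hdvd : (p : ℤ) - 1 ∣ ∑ i ∈ Finset.range t, (p : ℤ) ^ i := by
    have h1 : (p : ℤ) - 1 ∣ ∑ i ∈ Finset.range t, ((p : ℤ) ^ i - 1) :=
      Finset.dvd_sum fun i _ => sub_one_dvd_pow_sub_one _ _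
    have h2 : (p : ℤ) - 1 ∣ t := by
      have := Int.natCast_dvd_natCast.mpr ht
      rwa [Nat.cast_sub (by omega), Nat.cast_one] at this
    simpa using dvd_add h1 h2
  obtain ⟨w, hw⟩ := hdvd
  refine ⟨-(p : ℤ) ^ 2 * w, ?_⟩
  have hw' : ∑ i ∈ Finset.range t, (p : ℚ) ^ i = (p - 1) * w := by exact_mod_cast hw
  have hg := mul_geom_sum (p : ℚ) t
  rw [hw'] at hg
  have h3 : 1 - (p : ℚ) ^ t = -((p - 1) * ((p - 1) * w)) := by rw [hg]; ring
  rw [radicand, h3, ← neg_sub (p : ℚ) 1]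
  push_cast
  field_simp

lemma radicand_injective {p : ℕ} (hp : 2 ≤ p) : Function.Injective (radicand p) := by
  intro t t' h
  have hp1 : (1 : ℚ) < p := by exact_mod_cast hp
  have h1 : (1 - (p : ℚ)) ≠ 0 := by linarith
  have h0 : (p : ℚ) ≠ 0 := by linarith
  rw [radicand, radicand, div_left_inj' (pow_ne_zero 2 h1), mul_right_inj' (pow_ne_zero 2 h0),
    sub_right_inj] at h
  exact pow_right_injective₀ (by linarith) hp1.ne' h

/-! ### Square roots of the radicand -/

/-- The square root is `p u / (1 - p)`, which is the zeroth term of `familyQuotient`. -/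
lemma exists_sqrt_radicand {p : ℕ} [Fact p.Prime] (hp : p ≠ 2) {t : ℕ} (ht : 2 ≤ t) :
    ∃ β : ℚ_[p], β ^ 2 = (radicand p t : ℚ_[p]) ∧ ‖β / (p : ℚ_[p]) - 1‖ < 1 ∧
      ∀ ε : ℚ, (ε = 1 ∨ ε = -1) →
        HasValue p (familySeq p t ε) ((ε : ℚ_[p]) * β) ∧
        HasPeriodLength (familySeq p t ε) 4 ∧
        (5 ≤ p → HasExpansion p ((ε : ℚ_[p]) * β) (familySeq p t ε)) := by
  have hp2 : 2 ≤ p := (Fact.out : p.Prime).two_le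
  have hp1 : (1 : ℝ) < p := by exact_mod_cast hp2
  have hp0 : (p : ℚ_[p]) ≠ 0 := by exact_mod_cast (Fact.out : p.Prime).ne_zero
  obtain ⟨u, hu, hu1⟩ := exists_sq_eq_one_sub_pow hp (t := t) (by omega)
  have hlt : ‖-(p : ℚ_[p])‖ < ‖(1 : ℚ_[p])‖ := by
    rw [norm_neg, norm_one]
    exact Padic.norm_p_lt_one
  have n1 : ‖1 - (p : ℚ_[p])‖ = 1 := by rw [sub_eq_add_neg, norm_add_of_lt hlt, norm_one]
  have z1 : 1 - (p : ℚ_[p]) ≠ 0 := norm_ne_zero_iff.mp (by rw [n1]; exact one_ne_zero)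
  refine ⟨p * u / (1 - p), ?_, ?_, fun ε hε => ?_⟩
  · rw [radicand, div_pow, mul_pow, hu]
    push_cast
    rfl
  · rw [show p * u / (1 - p) / (p : ℚ_[p]) - 1 = (p + -(1 - u)) / (1 - p) by field_simp; ring,
      norm_div, n1, div_one]
    refine (IsUltrametricDist.norm_add_le_max _ _).trans_lt (max_lt Padic.norm_p_lt_one ?_)
    rw [norm_neg, hu1]
    exact inv_lt_one_of_one_lt₀ (one_lt_pow₀ hp1 (by omega))
  · have hseq : (fun n => ε * familySeq p t 1 n) = familySeq p t ε :=
      funext fun n => (familySeq_eq_mul n).symm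
    have h := (isQuotientSeq_family hp ht hu hu1).const_mul hε
    rw [hseq] at h
    have habs : |ε| = 1 := by rcases hε with rfl | rfl <;> simp
    have hε0 : ε ≠ 0 := by rintro rfl; simp at habs
    exact ⟨h.hasValue, hasPeriodLength_familySeq (by omega) ht hε0, fun h5 =>
      h.hasExpansion hp (exists_familySeq_mul_pow_eq_intCast hp2 hε)
        (fun n hn => two_mul_abs_familySeq_of_even_lt (by omega) habs hn)
        (fun n hn => two_mul_abs_familySeq_of_odd_lt h5 habs hn)⟩

end BrowkinII

open BrowkinII in
theorem mainTheorem1 (p : ℕ) [Fact p.Prime] (hp : p ≠ 2) :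
    (∀ t : ℕ, 2 ≤ t →
      ∃ β : ℚ_[p], β ^ 2 = (radicand p t : ℚ_[p]) ∧ ‖β / (p : ℚ_[p]) - 1‖ < 1 ∧
        ∀ ε : ℚ, (ε = 1 ∨ ε = -1) →
          HasValue p (familySeq p t ε) ((ε : ℚ_[p]) * β) ∧
          HasPeriodLength (familySeq p t ε) 4 ∧
          (5 ≤ p → HasExpansion p ((ε : ℚ_[p]) * β) (familySeq p t ε))) ∧
    {t : ℕ | 2 ≤ t ∧ ∃ m : ℤ, (m : ℚ) = radicand p t}.Infinite ∧
    (5 ≤ p →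
      {m : ℤ | (∃ t : ℕ, 2 ≤ t ∧ (m : ℚ) = radicand p t) ∧
        (∃ β : ℚ_[p], β ^ 2 = (m : ℚ_[p])) ∧
        ∀ β : ℚ_[p], β ^ 2 = (m : ℚ_[p]) →
          ∃ b : ℕ → ℚ, HasExpansion p β b ∧ HasPeriodLength b 4}.Infinite) := by
  have hp2 : 2 ≤ p := (Fact.out : p.Prime).two_le
  -- the exponents used for both infinitude claims are the positive multiples of `p - 1`
  have hmul : ∀ k, 2 ≤ (p - 1) * (k + 1) := fun k =>
    (show 2 ≤ p - 1 by omega).trans (Nat.le_mul_of_pos_right _ k.succ_pos)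
  have hinj : Function.Injective fun k => (p - 1) * (k + 1) := fun a b h => by
    simpa using Nat.eq_of_mul_eq_mul_left (by omega) h
  choose m hm using fun k => exists_intCast_eq_radicand hp2 (Dvd.intro (k + 1) rfl)
  refine ⟨fun t ht => exists_sqrt_radicand hp ht,
    Set.infinite_of_injective_forall_mem hinj fun k => ⟨hmul k, m k, hm k⟩, fun h5 =>
    Set.infinite_of_injective_forall_mem (f := m) (fun a b h => ?_) fun k => ?_⟩
  · exact hinj (radicand_injective hp2 (by rw [← hm a, ← hm b, h]))
  · obtain ⟨β, hβ, -, hexp⟩ := exists_sqrt_radicand hp (hmul k)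
    have hβm : β ^ 2 = (m k : ℚ_[p]) := by rw [hβ, ← hm k, Rat.cast_intCast]
    refine ⟨⟨_, hmul k, hm k⟩, ⟨β, hβm⟩, fun γ hγ => ?_⟩
    rcases sq_eq_sq_iff_eq_or_eq_neg.mp (hγ.trans hβm.symm) with rfl | rfl
    · obtain ⟨-, hper, he⟩ := hexp 1 (.inl rfl)
      exact ⟨_, by simpa using he h5, hper⟩
    · obtain ⟨-, hper, he⟩ := hexp (-1) (.inr rfl)
      exact ⟨_, by simpa using he h5, hper⟩
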